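/- **Theorem (first-order optimality under Robinson's condition).** Let $f, g_1,\dots,g_m, h_1,\dots,h_p : \mathbb{R}^n \to \mathbb{R}$ be continuously differentiable, let $P : \mathbb{R}^n \to \mathbb{R}$ be convex (not necessarily smooth), and let $X \subseteq \mathbb{R}^n$ be closed and convex. Consider the problem $$\min\ f(x) + P(x) \quad \text{s.t.} \quad g_i(x) \le 0\ (i = 1,\dots,m), \quad h_i(x) = 0\ (i = 1,\dots,p), \quad x \in X.$$ For $x \in X$ let $T_X(x)$ be the tangent cone to $X$ at $x$, i.e. the set of limits $\lim_k (x^k - x)/t_k$ with $x^k \in X$, $t_k > 0$, $t_k \to 0$; let $N_X(x) = \{v : v^T(y - x) \le 0 \text{ for all } y \in X\}$ be the normal cone, and let $\partial P(x) = \{z : P(y) \ge P(x) + z^T(y-x) \text{ for all } y \in \mathbb{R}^n\}$ be the subdifferential. Let $x^*$ be a local minimizer of this problem (in particular, a feasible point), put $\mathcal{A}(x^*) = \{i : g_i(x^*) = 0\}$, and assume that Robinson's condition holds at $x^*$: $$\left\{ \begin{bmatrix} g'(x^*) d - v \\ h'(x^*) d \end{bmatrix} : d \in T_X(x^*),\ v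 \in \mathbb{R}^m,\ v_i \le 0 \text{ for } i \in \mathcal{A}(x^*) \right\} = \mathbb{R}^m \times \mathbb{R}^p,$$ where $g'(x^*)$ and $h'(x^*)$ are the Jacobians of $g = (g_1,\dots,g_m)$ and $h = (h_1,\dots,h_p)$ at $x^*$. Then there exist $\lambda \in \mathbb{R}^m$ with $\lambda \ge 0$ and $\mu \in \mathbb{R}^p$ such that $$0 \in \nabla f(x^*) + \partial P(x^*) + \sum_{i=1}^m \lambda_i \nabla g_i(x^*) + \sum_{i=1}^p \mu_i \nabla h_i(x^*) + N_X(x^*)$$ and $$\lambda_i\, g_i(x^*) = 0, \qquad i = 1,\dots,m.$$ Moreover, the set of all such pairs $(\lambda,\mu) \in \mathbb{R}^m_+ \times \mathbb{R}^p$ is convex and compact. -/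

import Mathlib

open scoped Pointwise

namespace NonsmoothNLP

/-- The feasible region `{x ∈ X : g_i(x) ≤ 0 for all i, h_i(x) = 0 for all i}`. -/
def feasibleSet {n m p : ℕ}
    (g : Fin m → EuclideanSpace ℝ (Fin n) → ℝ) (h : Fin p → EuclideanSpace ℝ (Fin n) → ℝ)
    (X : Set (EuclideanSpace ℝ (Fin n))) : Set (EuclideanSpace ℝ (Fin n)) :=
  {x | (∀ i, g i x ≤ 0) ∧ (∀ i, h i x = 0) ∧ x ∈ X}

/-- `x` is a local minimizer of `F` over `Ω`: it is a feasible point, and `F x ≤ F y` for all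
feasible `y` close to `x`. -/
def IsLocalMinimizer {n : ℕ} (F : EuclideanSpace ℝ (Fin n) → ℝ)
    (Ω : Set (EuclideanSpace ℝ (Fin n))) (x : EuclideanSpace ℝ (Fin n)) : Prop :=
  x ∈ Ω ∧ IsLocalMinOn F Ω x

/-- The (convex) subdifferential `∂P(x)`. -/
def subdifferential {n : ℕ} (P : EuclideanSpace ℝ (Fin n) → ℝ)
    (x : EuclideanSpace ℝ (Fin n)) : Set (EuclideanSpace ℝ (Fin n)) :=
  {z | ∀ y, P x + inner ℝ z (y - x) ≤ P y}

/-- The normal cone `N_X(x)` of a convex set `X` (empty if `x ∉ X`). -/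
def normalCone {n : ℕ} (X : Set (EuclideanSpace ℝ (Fin n)))
    (x : EuclideanSpace ℝ (Fin n)) : Set (EuclideanSpace ℝ (Fin n)) :=
  {v | x ∈ X ∧ ∀ y ∈ X, inner ℝ v (y - x) ≤ 0}

/-- The set `𝒜(x)` of inequality constraints that are active at `x`. -/
def activeSet {n m : ℕ} (g : Fin m → EuclideanSpace ℝ (Fin n) → ℝ)
    (x : EuclideanSpace ℝ (Fin n)) : Set (Fin m) :=
  {i | g i x = 0}

/-- Robinson's condition at `x`: the vectors `(g'(x) d - v, h'(x) d)`, for `d` in the tangent cone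
`T_X(x)` and `v ∈ ℝᵐ` with `v_i ≤ 0` for the active `i`, fill out `ℝᵐ × ℝᵖ`.
The tangent cone is Mathlib's `posTangentConeAt`: for `x ∈ X`, its elements are the limits of
`(x_k - x) / t_k` with `x_k ∈ X`, `t_k > 0`, `t_k → 0`. -/
def RobinsonCondition {n m p : ℕ}
    (g : Fin m → EuclideanSpace ℝ (Fin n) → ℝ) (h : Fin p → EuclideanSpace ℝ (Fin n) → ℝ)
    (X : Set (EuclideanSpace ℝ (Fin n))) (x : EuclideanSpace ℝ (Fin n)) : Prop :=
  {w : (Fin m → ℝ) × (Fin p → ℝ) |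
    ∃ d ∈ posTangentConeAt X x, ∃ v : Fin m → ℝ, (∀ i ∈ activeSet g x, v i ≤ 0) ∧
      w = (fun i => fderiv ℝ (g i) x d - v i, fun i => fderiv ℝ (h i) x d)} = Set.univ

/-- The set `Λ(x)` of pairs `(λ, μ)` with `λ ≥ 0` that satisfy the stationarity inclusion
`0 ∈ ∇f(x) + ∂P(x) + ∑ λ_i ∇g_i(x) + ∑ μ_i ∇h_i(x) + N_X(x)` (sums of sets are Minkowski sums)
and complementary slackness `λ_i g_i(x) = 0`. -/
def multiplierSet {n m p : ℕ} (f P : EuclideanSpace ℝ (Fin n) → ℝ)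
    (g : Fin m → EuclideanSpace ℝ (Fin n) → ℝ) (h : Fin p → EuclideanSpace ℝ (Fin n) → ℝ)
    (X : Set (EuclideanSpace ℝ (Fin n))) (x : EuclideanSpace ℝ (Fin n)) :
    Set ((Fin m → ℝ) × (Fin p → ℝ)) :=
  {q | (∀ i, 0 ≤ q.1 i) ∧
    (0 : EuclideanSpace ℝ (Fin n)) ∈
      {gradient f x} + subdifferential P x + {∑ i, q.1 i • gradient (g i) x}
        + {∑ i, q.2 i • gradient (h i) x} + normalCone X x ∧
    ∀ i, q.1 i * g i x = 0}

end NonsmoothNLP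

/-!
The proof approximates the local minimizer by minimizers of penalized problems. Near `x`, the
function `f + P + (k / 2) (∑ max(0, g_i)² + ∑ h_i²) + ½‖· - x‖²` has minimizers over
the part of `X` in a small closed ball, and these converge to `x` along a subsequence
(`IsLocalMinimizer.exists_penalty_seq`). Those close to `x` satisfy a first-order condition,
written as a variational inequality over `X` in which the convex function `P` enters through its
increments (`nonneg_of_isLocalMinOn_add_convexOn`); the multiplier estimates
are `λ_i = k max(0, g_i)` and `μ_i = k h_i`.

Robinson's condition enters only in its dual form: the only `(λ, μ)` with `λ ≥ 0`, with `λ_i = 0`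
for inactive `i`, and with `∑ λ_i g_i'(x) + ∑ μ_i h_i'(x)` nonnegative on `X - x` is zero
(`RobinsonCondition.eq_zero`). Hence the multiplier estimates cannot blow up, since their normalized
limit would violate this (`RobinsonCondition.not_tendsto_norm_atTop`), and a limit point of
them is a multiplier. The same fact, applied at the constant sequence `x`, shows that the set of
multipliers is bounded.

The limiting variational inequality is equivalent to the stationarity inclusion
(`zero_mem_stationarity_iff`). Splitting it into a subgradient of `P` and a normal vector of `X`
is a separation of the strict epigraph of `P` from a convex hypograph over `X`
(`exists_mem_subdifferential_neg_mem_normalCone`); no qualification is needed, because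
`P` is finite, hence continuous, on the whole space. In the form of the variational inequality,
the set of multipliers is visibly closed and convex.
-/

namespace NonsmoothNLP

open Filter Topology Set

/-! ### First-order conditions on a convex set -/

section Normed

variable {E : Type*} [NormedAddCommGroup E] [NormedSpace ℝ E]

theorem hasDerivAt_max_zero_sq (t : ℝ) :
    HasDerivAt (fun s : ℝ => max 0 s ^ 2) (2 * max 0 t) t := by
  rw [hasDerivAt_iff_isLittleO]
  refine Asymptotics.IsBigO.trans_isLittleO (g := fun s : ℝ => (s - t) ^ 2) ?_ ?_
  · refine Asymptotics.IsBigO.of_bound 1 (Eventually.of_forall fun s => ?_)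
    rw [Real.norm_eq_abs, Real.norm_eq_abs, abs_of_nonneg (sq_nonneg (s - t)), abs_le, smul_eq_mul]
    rcases max_cases 0 s with ⟨hs, hs'⟩ | ⟨hs, hs'⟩ <;>
      rcases max_cases 0 t with ⟨ht, ht'⟩ | ⟨ht, ht'⟩ <;> rw [hs, ht] <;>
      constructor <;> nlinarith [sq_nonneg (s - t)]
  · have h : Tendsto (fun s : ℝ => s - t) (𝓝 t) (𝓝 0) := by
      simpa using (continuous_id.sub continuous_const).tendsto (f := fun s : ℝ => s - t) t
    have := ((Asymptotics.isLittleO_one_iff ℝ).2 h).mul_isBigO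
      (Asymptotics.isBigO_refl (fun s : ℝ => s - t) (𝓝 t))
    simpa [sq] using this

/-- First-order condition for the sum of a differentiable function `φ` and a convex function `P`
on a convex set: the directional derivative of `P` is replaced by the increment `P y - P x`, which
bounds it from above. -/
theorem nonneg_of_isLocalMinOn_add_convexOn {φ P : E → ℝ} {X : Set E} {x : E} {φ' : E →L[ℝ] ℝ}
    (hmin : IsLocalMinOn (fun z => φ z + P z) X x) (hφ : HasFDerivAt φ φ' x)
    (hP : ConvexOn ℝ univ P) (hX : Convex ℝ X) (hx : x ∈ X) {y : E} (hy : y ∈ X) :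
    0 ≤ φ' (y - x) + P y - P x := by
  -- the line `t ↦ x + t (y - x)`, along which `P` lies below its chord
  let ℓ : ℝ → E := fun t => x + t • (y - x)
  have hℓ : HasDerivAt ℓ (y - x) 0 := by
    simpa [ℓ] using ((hasDerivAt_id (0 : ℝ)).smul_const (y - x)).const_add x
  have hℓ0 : ℓ 0 = x := by simp [ℓ]
  have hℓX : ∀ t ∈ Icc (0 : ℝ) 1, ℓ t ∈ X := fun t ht => hX.add_smul_sub_mem hx hy ht
  have hψ : HasDerivAt (fun t => φ (ℓ t) + t * (P y - P x)) (φ' (y - x) + (P y - P x)) 0 := by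
    have h1 : HasDerivAt (fun t => φ (ℓ t)) (φ' (y - x)) 0 :=
      HasFDerivAt.comp_hasDerivAt (0 : ℝ) (by rwa [hℓ0]) hℓ
    have h2 : HasDerivAt (fun t : ℝ => t * (P y - P x)) (P y - P x) 0 := by
      simpa using (hasDerivAt_id (0 : ℝ)).mul_const (P y - P x)
    exact h1.fun_add h2
  have hloc : IsLocalMinOn (fun t => φ (ℓ t) + t * (P y - P x)) (Icc 0 1) 0 := by
    have ht : Tendsto ℓ (𝓝[Icc 0 1] 0) (𝓝[X] x) := by
      refine tendsto_nhdsWithin_iff.2 ⟨?_, eventually_mem_nhdsWithin.mono hℓX⟩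
      have := hℓ.continuousAt.tendsto
      rw [hℓ0] at this
      exact this.mono_left nhdsWithin_le_nhds
    filter_upwards [ht.eventually hmin, eventually_mem_nhdsWithin] with t h1 h2
    have h3 : P (ℓ t) ≤ (1 - t) * P x + t * P y := by
      have := hP.2 (mem_univ x) (mem_univ y) (sub_nonneg.2 h2.2) h2.1 (by ring)
      have he : ℓ t = (1 - t) • x + t • y := by simp only [ℓ]; module
      rw [he]
      simpa using this
    simp only [hℓ0, zero_mul, add_zero]
    linarith
  have := hloc.hasFDerivWithinAt_nonneg hψ.hasFDerivAt.hasFDerivWithinAt (y := (1 : ℝ))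
    (mem_posTangentConeAt_of_segment_subset (by
      rw [zero_add, segment_eq_Icc zero_le_one]))
  rw [ContinuousLinearMap.toSpanSingleton_apply, one_smul] at this
  linarith

theorem tendsto_clm_apply {ι : Type*} {l : Filter ι} {A : ι → E →L[ℝ] ℝ} {A₀ : E →L[ℝ] ℝ}
    {v : ι → E} {v₀ : E} (hA : Tendsto A l (𝓝 A₀)) (hv : Tendsto v l (𝓝 v₀)) :
    Tendsto (fun k => A k (v k)) l (𝓝 (A₀ v₀)) :=
  (isBoundedBilinearMap_apply.continuous.tendsto (A₀, v₀)).comp (hA.prodMk_nhds hv)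

end Normed

/-! ### The subdifferential sum rule -/

variable {n m p : ℕ}

theorem continuous_of_convexOn {P : EuclideanSpace ℝ (Fin n) → ℝ} (hP : ConvexOn ℝ univ P) :
    Continuous P :=
  continuousOn_univ.1 (hP.continuousOn isOpen_univ)

/-- If `x` minimizes `⟪w, ·⟫ + P` over `X`, then `-w` is the sum of a subgradient of `P` and a
normal vector of `X` at `x`. Both come from a functional separating the strict epigraph of `P` from the
set of `(u, t)` with `u ∈ X` and `t ≤ P x - ⟪w, u - x⟫`. -/
theorem exists_mem_subdifferential_neg_mem_normalCone {P : EuclideanSpace ℝ (Fin n) → ℝ}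
    {X : Set (EuclideanSpace ℝ (Fin n))} (hP : ConvexOn ℝ univ P) (hX : Convex ℝ X)
    {x w : EuclideanSpace ℝ (Fin n)} (hx : x ∈ X)
    (hw : ∀ y ∈ X, 0 ≤ inner ℝ w (y - x) + P y - P x) :
    ∃ z ∈ subdifferential P x, -(w + z) ∈ normalCone X x := by
  have hPc := continuous_of_convexOn hP
  have hB : Convex ℝ {b : EuclideanSpace ℝ (Fin n) × ℝ |
      b.1 ∈ X ∧ b.2 ≤ P x - inner ℝ w (b.1 - x)} := by
    rintro ⟨a, s⟩ ⟨ha, hs⟩ ⟨b, t⟩ ⟨hb, ht⟩ c d hc hd hcd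
    refine ⟨hX ha hb hc hd hcd, ?_⟩
    simp only [inner_sub_right, Prod.fst_add, Prod.smul_fst, Prod.snd_add, Prod.smul_snd,
      inner_add_right, inner_smul_right, smul_eq_mul] at hs ht ⊢
    have h1 := mul_le_mul_of_nonneg_left hs hc
    have h2 := mul_le_mul_of_nonneg_left ht hd
    obtain rfl : d = 1 - c := by linarith
    linarith
  obtain ⟨F, c, hA, hBF⟩ := geometric_hahn_banach_open
    (s := {a : EuclideanSpace ℝ (Fin n) × ℝ | a.1 ∈ univ ∧ P a.1 < a.2})
    hP.convex_strict_epigraph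
    (by simpa using isOpen_lt (hPc.comp continuous_fst) continuous_snd) hB
    (Set.disjoint_left.2 fun a ha hb => by
      have := hw a.1 hb.1
      have h1 := ha.2
      have h2 := hb.2
      linarith)
  have hF : ∀ u t, F (u, t) = F (u, 0) + t * F (0, 1) := fun u t => by
    rw [← smul_eq_mul, ← map_smul, ← map_add]
    simp
  have hFs : ∀ u v, F (u - v, 0) = F (u, 0) - F (v, 0) := fun u v => by
    rw [← map_sub]
    simp
  set β := F (0, 1) with hβdef
  have hA' : ∀ u t, P u < t → F (u, 0) + t * β < c := fun u t h => by
    rw [← hF]; exact hA _ ⟨mem_univ _, h⟩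
  -- the inequality on the open strict epigraph extends to the graph of `P`
  have hA'' : ∀ u, F (u, 0) + P u * β ≤ c := fun u => by
    have ht : Tendsto (fun t => F (u, 0) + t * β) (𝓝[>] (P u)) (𝓝 (F (u, 0) + P u * β)) :=
      ((continuous_const.add (continuous_id.mul continuous_const)).tendsto
        (f := fun t => F (u, 0) + t * β) (P u)).mono_left nhdsWithin_le_nhds
    exact le_of_tendsto ht (eventually_mem_nhdsWithin.mono fun t h => (hA' u t h).le)
  have hB' : ∀ y ∈ X, c ≤ F (y, 0) + (P x - inner ℝ w (y - x)) * β := fun y hy => by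
    rw [← hF]; exact hBF _ ⟨hy, le_rfl⟩
  have hcx : c ≤ F (x, 0) + P x * β := by simpa using hB' x hx
  -- the separating hyperplane is not vertical, since all of `{x} × (P x, ∞)` lies on one side of
  -- `(x, P x)`
  have hβ : β < 0 := by
    have := hA' x (P x + 1) (by linarith)
    linarith
  let z : EuclideanSpace ℝ (Fin n) := (InnerProductSpace.toDual ℝ _).symm
    ((-β)⁻¹ • (F.comp (ContinuousLinearMap.inl ℝ _ ℝ)))
  have hz : ∀ u, F (u, 0) = -β * inner ℝ z u := fun u => by
    have hne : -β ≠ 0 := by linarith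
    simp only [z, InnerProductSpace.toDual_symm_apply]
    simp only [smul_apply, ContinuousLinearMap.comp_apply,
      ContinuousLinearMap.inl_apply, smul_eq_mul]
    rw [mul_inv_cancel_left₀ hne]
  refine ⟨z, fun y => ?_, hx, fun y hy => ?_⟩
  · have h1 := hA'' y
    have h2 := hz (y - x)
    rw [hFs] at h2
    nlinarith
  · have h1 := hB' y hy
    have h2 := hz (y - x)
    have h3 := hA'' x
    rw [hFs] at h2
    rw [inner_neg_left, inner_add_left]
    nlinarith

/-! ### Stationarity as a variational inequality -/

/-- The derivative `∑ λ_i g_i'(x) + ∑ μ_i h_i'(x)` at `x` of the constraint part of the Lagrangian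
with multipliers `q = (λ, μ)`, as a linear functional. -/
noncomputable def constraintDeriv (g : Fin m → EuclideanSpace ℝ (Fin n) → ℝ)
    (h : Fin p → EuclideanSpace ℝ (Fin n) → ℝ) (x : EuclideanSpace ℝ (Fin n))
    (q : (Fin m → ℝ) × (Fin p → ℝ)) : EuclideanSpace ℝ (Fin n) →L[ℝ] ℝ :=
  ∑ i, q.1 i • fderiv ℝ (g i) x + ∑ i, q.2 i • fderiv ℝ (h i) x

variable {f P : EuclideanSpace ℝ (Fin n) → ℝ} {g : Fin m → EuclideanSpace ℝ (Fin n) → ℝ}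
  {h : Fin p → EuclideanSpace ℝ (Fin n) → ℝ} {X : Set (EuclideanSpace ℝ (Fin n))}
  {x : EuclideanSpace ℝ (Fin n)}

theorem constraintDeriv_apply (q : (Fin m → ℝ) × (Fin p → ℝ)) (d : EuclideanSpace ℝ (Fin n)) :
    constraintDeriv g h x q d =
      ∑ i, q.1 i * fderiv ℝ (g i) x d + ∑ i, q.2 i * fderiv ℝ (h i) x d := by
  simp [constraintDeriv]

theorem constraintDeriv_smul (c : ℝ) (q : (Fin m → ℝ) × (Fin p → ℝ)) :
    constraintDeriv g h x (c • q) = c • constraintDeriv g h x q := by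
  simp [constraintDeriv, Finset.smul_sum, smul_smul]

theorem constraintDeriv_add (q r : (Fin m → ℝ) × (Fin p → ℝ)) :
    constraintDeriv g h x (q + r) = constraintDeriv g h x q + constraintDeriv g h x r := by
  simp only [constraintDeriv, Prod.fst_add, Prod.snd_add, Pi.add_apply, add_smul,
    Finset.sum_add_distrib]
  abel

theorem tendsto_constraintDeriv (hg : ∀ i, ContDiff ℝ 1 (g i)) (hh : ∀ i, ContDiff ℝ 1 (h i))
    {ι : Type*} {l : Filter ι} {y : ι → EuclideanSpace ℝ (Fin n)}
    {q : ι → (Fin m → ℝ) × (Fin p → ℝ)} {q₀ : (Fin m → ℝ) × (Fin p → ℝ)}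
    (hy : Tendsto y l (𝓝 x)) (hq : Tendsto q l (𝓝 q₀)) :
    Tendsto (fun k => constraintDeriv g h (y k) (q k)) l (𝓝 (constraintDeriv g h x q₀)) := by
  have hq1 : ∀ i, Tendsto (fun k => (q k).1 i) l (𝓝 (q₀.1 i)) := fun i =>
    (((continuous_apply i).comp continuous_fst).tendsto q₀).comp hq
  have hq2 : ∀ i, Tendsto (fun k => (q k).2 i) l (𝓝 (q₀.2 i)) := fun i =>
    (((continuous_apply i).comp continuous_snd).tendsto q₀).comp hq
  have hg' : ∀ i, Tendsto (fun k => fderiv ℝ (g i) (y k)) l (𝓝 (fderiv ℝ (g i) x)) := fun i =>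
    (((hg i).continuous_fderiv one_ne_zero).tendsto x).comp hy
  have hh' : ∀ i, Tendsto (fun k => fderiv ℝ (h i) (y k)) l (𝓝 (fderiv ℝ (h i) x)) := fun i =>
    (((hh i).continuous_fderiv one_ne_zero).tendsto x).comp hy
  exact (tendsto_finsetSum _ fun i _ => (hq1 i).smul (hg' i)).add
    (tendsto_finsetSum _ fun i _ => (hq2 i).smul (hh' i))

/-- The stationarity inclusion is a variational inequality over `X`. This is the sum rule
`∂(P + δ_X)(x) = ∂P(x) + N_X(x)` for the indicator function `δ_X` of `X`. -/
theorem zero_mem_stationarity_iff (hP : ConvexOn ℝ univ P) (hX : Convex ℝ X) (hx : x ∈ X)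
    (q : (Fin m → ℝ) × (Fin p → ℝ)) :
    (0 : EuclideanSpace ℝ (Fin n)) ∈
      {gradient f x} + subdifferential P x + {∑ i, q.1 i • gradient (g i) x}
        + {∑ i, q.2 i • gradient (h i) x} + normalCone X x ↔
    ∀ y ∈ X, 0 ≤ (fderiv ℝ f x + constraintDeriv g h x q) (y - x) + P y - P x := by
  set w : EuclideanSpace ℝ (Fin n) := gradient f x + ∑ i, q.1 i • gradient (g i) x
    + ∑ i, q.2 i • gradient (h i) x with hw
  have hwd : ∀ d, (fderiv ℝ f x + constraintDeriv g h x q) d = inner ℝ w d := fun d => by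
    simp only [hw, inner_add_left, sum_inner, inner_smul_left, gradient,
      InnerProductSpace.toDual_symm_apply, add_apply, constraintDeriv_apply]
    simp [add_assoc]
  simp only [hwd]
  constructor
  · rintro ⟨_, ⟨_, ⟨_, ⟨_, rfl, z, hz, rfl⟩, _, rfl, rfl⟩, _, rfl, rfl⟩, v, hv, h0⟩ y hy
    have hwz : w = -(z + v) := by
      rw [eq_neg_iff_add_eq_zero, ← h0, hw]
      simp only
      abel
    have h1 := hz y
    have h2 := hv.2 y hy
    rw [hwz, inner_neg_left, inner_add_left]
    linarith
  · intro hvi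
    obtain ⟨z, hz, hv⟩ := exists_mem_subdifferential_neg_mem_normalCone hP hX hx hvi
    refine ⟨_, ⟨_, ⟨_, ⟨_, rfl, z, hz, rfl⟩, _, rfl, rfl⟩, _, rfl, rfl⟩, _, hv, ?_⟩
    simp only [hw]
    abel

/-! ### Consequences of Robinson's condition -/

/-- Dual form of Robinson's condition: only the zero multiplier is singular, where `q = (λ, μ)` is
called singular if `λ ≥ 0` vanishes off the active set and the functional `constraintDeriv g h x q`
is nonnegative on `X - x`. Such a functional is nonnegative on `T_X(x)`, while Robinson's condition
represents `-(λ, μ)` itself as `(g'(x) d - v, h'(x) d)`; pairing the two gives `-(|λ|² + |μ|²) ≥ 0`. -/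
theorem RobinsonCondition.eq_zero (hrob : RobinsonCondition g h X x)
    {q : (Fin m → ℝ) × (Fin p → ℝ)} (hq : ∀ i, 0 ≤ q.1 i)
    (hact : ∀ i, g i x ≠ 0 → q.1 i = 0)
    (hvi : ∀ y ∈ X, 0 ≤ constraintDeriv g h x q (y - x)) : q = 0 := by
  have hmem : -q ∈ (univ : Set ((Fin m → ℝ) × (Fin p → ℝ))) := mem_univ _
  rw [← hrob] at hmem
  obtain ⟨d, hd, v, hv, hdv⟩ := hmem
  have hmin : IsLocalMinOn (constraintDeriv g h x q) X x :=
    IsMinOn.localize fun y hy => by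
      have := hvi y hy
      rw [map_sub] at this
      simpa using this
  have hpos := hmin.hasFDerivWithinAt_nonneg
    (constraintDeriv g h x q).hasFDerivAt.hasFDerivWithinAt hd
  rw [constraintDeriv_apply] at hpos
  have h1 : ∀ i, q.1 i * fderiv ℝ (g i) x d ≤ -(q.1 i * q.1 i) := fun i => by
    have e : -q.1 i = fderiv ℝ (g i) x d - v i := congrFun (congrArg Prod.fst hdv) i
    have hvi : q.1 i * v i ≤ 0 := by
      by_cases hi : g i x = 0
      · exact mul_nonpos_of_nonneg_of_nonpos (hq i) (hv i hi)
      · simp [hact i hi]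
    have : fderiv ℝ (g i) x d = v i - q.1 i := by linarith
    rw [this]
    linarith
  have h2 : ∀ i, q.2 i * fderiv ℝ (h i) x d = -(q.2 i * q.2 i) := fun i => by
    have e : -q.2 i = fderiv ℝ (h i) x d := congrFun (congrArg Prod.snd hdv) i
    rw [← e]
    ring
  have h3 := Finset.sum_le_sum fun i (_ : i ∈ Finset.univ) => h1 i
  simp only [h2, Finset.sum_neg_distrib] at hpos h3
  have h4 : 0 ≤ ∑ i, q.1 i * q.1 i := Finset.sum_nonneg fun i _ => mul_self_nonneg _
  have h5 : 0 ≤ ∑ i, q.2 i * q.2 i := Finset.sum_nonneg fun i _ => mul_self_nonneg _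
  have h6 : ∑ i, q.1 i * q.1 i = 0 := by linarith
  have h7 : ∑ i, q.2 i * q.2 i = 0 := by linarith
  rw [Finset.sum_eq_zero_iff_of_nonneg fun i _ => mul_self_nonneg _] at h6 h7
  ext i
  · simpa using h6 i (Finset.mem_univ i)
  · simpa using h7 i (Finset.mem_univ i)

/-- Multipliers of approximately stationary points `y k → x` cannot blow up: otherwise, the
normalized multipliers would cluster at a nonzero singular multiplier at `x`. -/
theorem RobinsonCondition.not_tendsto_norm_atTop (hrob : RobinsonCondition g h X x)
    (hg : ∀ i, ContDiff ℝ 1 (g i)) (hh : ∀ i, ContDiff ℝ 1 (h i)) (hP : Continuous P)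
    {y : ℕ → EuclideanSpace ℝ (Fin n)} (hy : Tendsto y atTop (𝓝 x))
    {r : ℕ → EuclideanSpace ℝ (Fin n) →L[ℝ] ℝ} {r₀ : EuclideanSpace ℝ (Fin n) →L[ℝ] ℝ}
    (hr : Tendsto r atTop (𝓝 r₀)) {q : ℕ → (Fin m → ℝ) × (Fin p → ℝ)}
    (hq : ∀ k i, 0 ≤ (q k).1 i) (hact : ∀ i, g i x ≠ 0 → ∀ᶠ k in atTop, (q k).1 i = 0)
    (hvi : ∀ k, ∀ z ∈ X, 0 ≤ (r k + constraintDeriv g h (y k) (q k)) (z - y k) + P z - P (y k)) :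
    ¬ Tendsto (fun k => ‖q k‖) atTop atTop := by
  intro hinf
  let u : ℕ → (Fin m → ℝ) × (Fin p → ℝ) := fun k => ‖q k‖⁻¹ • q k
  have hu1 : ∀ᶠ k in atTop, ‖u k‖ = 1 := by
    filter_upwards [hinf.eventually_gt_atTop 0] with k hk
    simp [u, norm_smul, hk.ne']
  obtain ⟨u₀, -, φ, hφ, hu⟩ := tendsto_subseq_of_frequently_bounded (x := u)
    (Metric.isBounded_closedBall (x := (0 : (Fin m → ℝ) × (Fin p → ℝ))) (r := 1))
    (hu1.mono fun k hk => by simp [hk.le]).frequently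
  have hφt := hφ.tendsto_atTop
  have hnorm : ‖u₀‖ = 1 :=
    tendsto_nhds_unique hu.norm (tendsto_const_nhds.congr' ((hφt.eventually hu1).mono
      fun k hk => hk.symm))
  have hcoord : ∀ i, Tendsto (fun k => (u (φ k)).1 i) atTop (𝓝 (u₀.1 i)) := fun i =>
    (((continuous_apply i).comp continuous_fst).tendsto u₀).comp hu
  have hu0 : u₀ = 0 := by
    refine hrob.eq_zero (fun i => ?_) (fun i hi => ?_) (fun z hz => ?_)
    · exact ge_of_tendsto' (hcoord i) fun k =>
        mul_nonneg (inv_nonneg.2 (norm_nonneg _)) (hq _ i)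
    · refine tendsto_nhds_unique (hcoord i) (tendsto_const_nhds.congr' ?_)
      filter_upwards [hφt.eventually (hact i hi)] with k hk
      simp [u, hk]
    · have hyφ : Tendsto (fun k => y (φ k)) atTop (𝓝 x) := hy.comp hφt
      have hinv : Tendsto (fun k => ‖q (φ k)‖⁻¹) atTop (𝓝 0) :=
        (tendsto_inv_atTop_zero.comp hinf).comp hφt
      have hzy : Tendsto (fun k => z - y (φ k)) atTop (𝓝 (z - x)) := tendsto_const_nhds.sub hyφ
      have hrφ : Tendsto (fun k => r (φ k)) atTop (𝓝 r₀) := hr.comp hφt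
      have h1 := tendsto_clm_apply hrφ hzy
      have h2 : Tendsto (fun k => P (y (φ k))) atTop (𝓝 (P x)) := (hP.tendsto x).comp hyφ
      have h3 : Tendsto (fun k => constraintDeriv g h (y (φ k)) (u (φ k))) atTop
          (𝓝 (constraintDeriv g h x u₀)) :=
        tendsto_constraintDeriv hg hh hyφ hu
      have h4 := (hinv.mul ((h1.add_const (P z)).sub h2)).add (tendsto_clm_apply h3 hzy)
      rw [zero_mul, zero_add] at h4
      refine ge_of_tendsto' h4 fun k => ?_
      have h5 := mul_nonneg (inv_nonneg.2 (norm_nonneg (q (φ k)))) (hvi (φ k) z hz)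
      simp only [u, constraintDeriv_smul, add_apply, smul_apply,
        smul_eq_mul] at h5 ⊢
      linarith
  rw [hu0, norm_zero] at hnorm
  exact zero_ne_one hnorm

/-! ### Penalty approximation -/

/-- The quadratic penalty `∑ max(0, g_i)² + ∑ h_i²` for the constraints `g ≤ 0`, `h = 0`. -/
noncomputable def penalty (g : Fin m → EuclideanSpace ℝ (Fin n) → ℝ)
    (h : Fin p → EuclideanSpace ℝ (Fin n) → ℝ) (x : EuclideanSpace ℝ (Fin n)) : ℝ :=
  ∑ i, max 0 (g i x) ^ 2 + ∑ i, h i x ^ 2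

theorem penalty_nonneg : 0 ≤ penalty g h x :=
  add_nonneg (Finset.sum_nonneg fun _ _ => sq_nonneg _) (Finset.sum_nonneg fun _ _ => sq_nonneg _)

theorem penalty_eq_zero_iff : penalty g h x = 0 ↔ (∀ i, g i x ≤ 0) ∧ ∀ i, h i x = 0 := by
  rw [penalty, add_eq_zero_iff_of_nonneg (Finset.sum_nonneg fun _ _ => sq_nonneg _)
    (Finset.sum_nonneg fun _ _ => sq_nonneg _),
    Finset.sum_eq_zero_iff_of_nonneg fun _ _ => sq_nonneg _,
    Finset.sum_eq_zero_iff_of_nonneg fun _ _ => sq_nonneg _]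
  simp

theorem continuous_penalty (hg : ∀ i, Continuous (g i)) (hh : ∀ i, Continuous (h i)) :
    Continuous (penalty g h) := by
  unfold penalty
  fun_prop

theorem hasFDerivAt_penalty (hg : ∀ i, Differentiable ℝ (g i))
    (hh : ∀ i, Differentiable ℝ (h i)) (c : ℝ) (x : EuclideanSpace ℝ (Fin n)) :
    HasFDerivAt (fun z => c / 2 * penalty g h z)
      (constraintDeriv g h x (fun i => c * max 0 (g i x), fun i => c * h i x)) x := by
  have h1 : HasFDerivAt (fun z => ∑ i, max 0 (g i z) ^ 2)
      (∑ i, (2 * max 0 (g i x)) • fderiv ℝ (g i) x) x :=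
    HasFDerivAt.fun_sum fun i _ =>
      (hasDerivAt_max_zero_sq (g i x)).comp_hasFDerivAt x (hg i x).hasFDerivAt
  have h2 : HasFDerivAt (fun z => ∑ i, h i z ^ 2) (∑ i, (2 * h i x) • fderiv ℝ (h i) x) x :=
    HasFDerivAt.fun_sum fun i _ => by
      simpa using (hh i x).hasFDerivAt.pow 2
  refine ((h1.add h2).const_mul (c / 2)).congr_fderiv ?_
  simp only [constraintDeriv, smul_add, Finset.smul_sum, smul_smul]
  congr 1 <;> refine Finset.sum_congr rfl fun i _ => ?_ <;> congr 1 <;> ring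

/-- Penalty approximation: near a local minimizer `x` there are points `y k → x` at which the
penalized problem is stationary over `X`, with multiplier estimates `c k * max(0, g_i)`
and `c k * h_i`. The proximal term `½‖· - x‖²` singles out `x` among the solutions nearby. -/
theorem IsLocalMinimizer.exists_penalty_seq
    (hmin : IsLocalMinimizer (fun z => f z + P z) (feasibleSet g h X) x)
    (hf : Differentiable ℝ f) (hg : ∀ i, Differentiable ℝ (g i))
    (hh : ∀ i, Differentiable ℝ (h i)) (hP : ConvexOn ℝ univ P) (hXc : IsClosed X)
    (hX : Convex ℝ X) :
    ∃ (y : ℕ → EuclideanSpace ℝ (Fin n)) (c : ℕ → ℝ), Tendsto y atTop (𝓝 x) ∧ (∀ k, 0 ≤ c k) ∧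
      ∀ k, ∀ z ∈ X, 0 ≤ ((fderiv ℝ f (y k) + innerSL ℝ (y k - x)) + constraintDeriv g h (y k)
        (fun i => c k * max 0 (g i (y k)), fun i => c k * h i (y k))) (z - y k)
          + P z - P (y k) := by
  have hPc := continuous_of_convexOn hP
  obtain ⟨⟨hgx, hhx, hxX⟩, hloc⟩ := hmin
  obtain ⟨δ, hδ, hball⟩ := Metric.eventually_nhds_iff_ball.1 (eventually_nhdsWithin_iff.1 hloc)
  let K : Set (EuclideanSpace ℝ (Fin n)) := X ∩ Metric.closedBall x (δ / 2)
  have hK : IsCompact K := (isCompact_closedBall x (δ / 2)).inter_left hXc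
  have hxK : x ∈ K := ⟨hxX, Metric.mem_closedBall_self (by positivity)⟩
  have hpx : penalty g h x = 0 := penalty_eq_zero_iff.2 ⟨hgx, hhx⟩
  let F : EuclideanSpace ℝ (Fin n) → ℝ := fun z => f z + P z + 1 / 2 * ‖z - x‖ ^ 2
  have hpen := continuous_penalty (fun i => (hg i).continuous) fun i => (hh i).continuous
  have hFc : Continuous F := by
    have := hf.continuous
    fun_prop
  have hFx : F x = f x + P x := by simp [F]
  have hex : ∀ k : ℕ, ∃ a ∈ K, IsMinOn (fun z => F z + (k : ℝ) / 2 * penalty g h z) K a := fun k =>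
    hK.exists_isMinOn ⟨x, hxK⟩ (by fun_prop)
  choose a haK hamin using hex
  have hale : ∀ k : ℕ, F (a k) + (k : ℝ) / 2 * penalty g h (a k) ≤ F x := fun k => by
    simpa [hpx] using hamin k hxK
  obtain ⟨b, hbK, hb⟩ := hK.exists_isMinOn ⟨x, hxK⟩ hFc.continuousOn
  obtain ⟨x₀, hx₀K, φ, hφ, hlim⟩ := hK.tendsto_subseq haK
  have hφt := hφ.tendsto_atTop
  -- the penalties are `O(1 / k)`, so the cluster point is feasible
  have hpen0 : penalty g h x₀ = 0 := by
    have h1 : Tendsto (fun k => 2 * (F x - F b) / (φ k : ℝ)) atTop (𝓝 0) :=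
      tendsto_const_nhds.div_atTop (tendsto_natCast_atTop_atTop.comp hφt)
    have h2 : Tendsto (fun k => penalty g h (a (φ k))) atTop (𝓝 (penalty g h x₀)) :=
      (hpen.tendsto x₀).comp hlim
    refine le_antisymm (le_of_tendsto_of_tendsto h2 h1 ?_) penalty_nonneg
    filter_upwards [hφt.eventually_gt_atTop 0] with k hk
    have hk' : (0 : ℝ) < φ k := by exact_mod_cast hk
    rw [le_div_iff₀ hk']
    have h3 := hale (φ k)
    have h4 : F b ≤ F (a (φ k)) := hb (haK _)
    linarith
  have hFx₀ : F x₀ ≤ F x := by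
    refine le_of_tendsto' ((hFc.tendsto x₀).comp hlim) fun k => ?_
    have h1 := hale (φ k)
    have h2 : 0 ≤ ((φ k : ℕ) : ℝ) / 2 * penalty g h (a (φ k)) :=
      mul_nonneg (by positivity) penalty_nonneg
    simp only [Function.comp_apply]
    linarith
  have hx₀ : x₀ = x := by
    obtain ⟨h1, h2⟩ := penalty_eq_zero_iff.1 hpen0
    have h3 : f x + P x ≤ f x₀ + P x₀ :=
      hball x₀ (Metric.closedBall_subset_ball (by linarith) hx₀K.2) ⟨h1, h2, hx₀K.1⟩
    have h4 : ‖x₀ - x‖ ^ 2 ≤ 0 := by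
      simp only [hFx] at hFx₀
      simp only [F] at hFx₀
      linarith
    exact sub_eq_zero.1 (norm_eq_zero.1 (pow_eq_zero_iff two_ne_zero |>.1
      (le_antisymm h4 (sq_nonneg _))))
  subst hx₀
  -- eventually the minimizers over `K` lie in the interior of the ball, hence are local over `X`
  obtain ⟨N, hN⟩ := eventually_atTop.1
    (hlim.eventually (Metric.ball_mem_nhds x₀ (half_pos hδ)))
  refine ⟨fun k => a (φ (k + N)), fun k => φ (k + N), ?_, fun k => Nat.cast_nonneg _,
    fun k z hz => ?_⟩
  · exact (tendsto_add_atTop_iff_nat N).2 hlim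
  · set y := a (φ (k + N)) with hy
    set c : ℝ := (φ (k + N) : ℝ) with hc
    have hyball : y ∈ Metric.ball x₀ (δ / 2) := hN (k + N) (Nat.le_add_left _ _)
    have hlocy : IsLocalMinOn
        (fun z => (f z + 1 / 2 * ‖z - x₀‖ ^ 2 + c / 2 * penalty g h z) + P z) X y := by
      filter_upwards [eventually_mem_nhdsWithin,
        mem_nhdsWithin_of_mem_nhds (Metric.isOpen_ball.mem_nhds hyball)] with z hz1 hz2
      have h1 := hamin (φ (k + N)) ⟨hz1, Metric.ball_subset_closedBall hz2⟩
      simp only [mem_ofPred_eq, F, ← hy, ← hc] at h1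
      linarith
    have hnorm : HasFDerivAt (fun z => 1 / 2 * ‖z - x₀‖ ^ 2) (innerSL ℝ (y - x₀)) y := by
      refine ((((hasFDerivAt_id y).sub_const x₀).norm_sq).const_mul (1 / 2)).congr_fderiv ?_
      ext d
      simp
    have hd := (((hf y).hasFDerivAt.add hnorm).add (hasFDerivAt_penalty hg hh c y))
    exact nonneg_of_isLocalMinOn_add_convexOn hlocy hd hP hX (haK _).1 hz

/-! ### The set of multipliers -/

theorem mem_multiplierSet_iff (hP : ConvexOn ℝ univ P) (hX : Convex ℝ X) (hx : x ∈ X)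
    (q : (Fin m → ℝ) × (Fin p → ℝ)) :
    q ∈ multiplierSet f P g h X x ↔ (∀ i, 0 ≤ q.1 i) ∧
      (∀ y ∈ X, 0 ≤ (fderiv ℝ f x + constraintDeriv g h x q) (y - x) + P y - P x) ∧
      ∀ i, q.1 i * g i x = 0 := by
  rw [← zero_mem_stationarity_iff hP hX hx]
  rfl

theorem convex_multiplierSet (hP : ConvexOn ℝ univ P) (hX : Convex ℝ X) (hx : x ∈ X) :
    Convex ℝ (multiplierSet f P g h X x) := by
  intro q hq r hr s t hs ht hst
  rw [mem_multiplierSet_iff hP hX hx] at hq hr ⊢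
  refine ⟨fun i => add_nonneg (mul_nonneg hs (hq.1 i)) (mul_nonneg ht (hr.1 i)),
    fun y hy => ?_, fun i => ?_⟩
  · have h1 := mul_nonneg hs (hq.2.1 y hy)
    have h2 := mul_nonneg ht (hr.2.1 y hy)
    simp only [constraintDeriv_add, constraintDeriv_smul, add_apply,
      smul_apply, smul_eq_mul] at h1 h2 ⊢
    obtain rfl : t = 1 - s := by linarith
    linarith
  · have h1 := hq.2.2 i
    have h2 := hr.2.2 i
    simp only [Prod.fst_add, Prod.smul_fst, Pi.add_apply, Pi.smul_apply, smul_eq_mul]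
    linear_combination s * h1 + t * h2

theorem isClosed_multiplierSet (hP : ConvexOn ℝ univ P) (hX : Convex ℝ X) (hx : x ∈ X) :
    IsClosed (multiplierSet f P g h X x) := by
  have hc : Continuous fun q => constraintDeriv g h x q := by
    unfold constraintDeriv
    fun_prop
  have hset : multiplierSet f P g h X x = {q | ∀ i, 0 ≤ q.1 i} ∩
      ({q | ∀ y ∈ X, 0 ≤ (fderiv ℝ f x + constraintDeriv g h x q) (y - x) + P y - P x} ∩
        {q | ∀ i, q.1 i * g i x = 0}) :=
    Set.ext fun q => mem_multiplierSet_iff hP hX hx q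
  rw [hset]
  simp only [ofPred_forall]
  refine .inter (isClosed_iInter fun i => ?_) (.inter
    (isClosed_iInter fun y => isClosed_iInter fun _ => ?_) (isClosed_iInter fun i => ?_))
  · exact isClosed_le continuous_const (by fun_prop)
  · exact isClosed_le continuous_const
      ((((continuous_const.add hc).clm_apply continuous_const).add_const _).sub continuous_const)
  · exact isClosed_eq (by fun_prop) continuous_const

/-- Multipliers at `x` with norms tending to infinity would be multipliers of the constant sequence
`x` that blow up. -/
theorem isBounded_multiplierSet (hg : ∀ i, ContDiff ℝ 1 (g i)) (hh : ∀ i, ContDiff ℝ 1 (h i))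
    (hP : ConvexOn ℝ univ P) (hX : Convex ℝ X) (hx : x ∈ X) (hrob : RobinsonCondition g h X x) :
    Bornology.IsBounded (multiplierSet f P g h X x) := by
  by_contra hb
  rw [isBounded_iff_forall_norm_le] at hb
  push Not at hb
  choose q hq hqn using fun k : ℕ => hb k
  have hq' := fun k => (mem_multiplierSet_iff hP hX hx (q k)).1 (hq k)
  refine hrob.not_tendsto_norm_atTop hg hh (continuous_of_convexOn hP) (y := fun _ => x)
    tendsto_const_nhds (r := fun _ => fderiv ℝ f x) tendsto_const_nhds (q := q)
    (fun k => (hq' k).1) (fun i hi => Eventually.of_forall fun k => ?_) (fun k => (hq' k).2.1)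
    (tendsto_atTop_mono (fun k => (hqn k).le) tendsto_natCast_atTop_atTop)
  exact (mul_eq_zero.1 ((hq' k).2.2 i)).resolve_right hi

/-- A limit point of the multiplier estimates of the penalty approximation is a multiplier. -/
theorem multiplierSet_nonempty (hf : ContDiff ℝ 1 f) (hg : ∀ i, ContDiff ℝ 1 (g i))
    (hh : ∀ i, ContDiff ℝ 1 (h i)) (hP : ConvexOn ℝ univ P) (hXc : IsClosed X) (hX : Convex ℝ X)
    (hmin : IsLocalMinimizer (fun z => f z + P z) (feasibleSet g h X) x)
    (hrob : RobinsonCondition g h X x) : (multiplierSet f P g h X x).Nonempty := by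
  have hPc := continuous_of_convexOn hP
  obtain ⟨y, c, hy, hc, hvi⟩ := hmin.exists_penalty_seq (hf.differentiable one_ne_zero)
    (fun i => (hg i).differentiable one_ne_zero) (fun i => (hh i).differentiable one_ne_zero)
    hP hXc hX
  obtain ⟨⟨hgx, -, hxX⟩, -⟩ := hmin
  let q : ℕ → (Fin m → ℝ) × (Fin p → ℝ) := fun k =>
    (fun i => c k * max 0 (g i (y k)), fun i => c k * h i (y k))
  have hq : ∀ k i, 0 ≤ (q k).1 i := fun k i => mul_nonneg (hc k) (le_max_left _ _)
  have hact : ∀ i, g i x ≠ 0 → ∀ᶠ k in atTop, (q k).1 i = 0 := fun i hi => by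
    have h1 := (((hg i).continuous.tendsto x).comp hy).eventually_lt_const
      (lt_of_le_of_ne (hgx i) hi)
    filter_upwards [h1] with k hk
    simp only [q, max_eq_left (show g i (y k) ≤ 0 from hk.le), mul_zero]
  have hr : Tendsto (fun k => fderiv ℝ f (y k) + innerSL ℝ (y k - x)) atTop
      (𝓝 (fderiv ℝ f x)) := by
    have h1 : Continuous fun z => fderiv ℝ f z + innerSL ℝ (z - x) :=
      (hf.continuous_fderiv one_ne_zero).add
        ((innerSL ℝ).continuous.comp (continuous_id.sub continuous_const))
    simpa [Function.comp_def] using (h1.tendsto x).comp hy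
  have hbdd := hrob.not_tendsto_norm_atTop hg hh hPc hy hr hq hact hvi
  obtain ⟨C, hC⟩ : ∃ C, ∃ᶠ k in atTop, ‖q k‖ < C := by
    rw [tendsto_atTop] at hbdd
    push Not at hbdd
    exact hbdd
  obtain ⟨q₀, -, φ, hφ, hlim⟩ := tendsto_subseq_of_frequently_bounded
    (Metric.isBounded_ball (x := (0 : (Fin m → ℝ) × (Fin p → ℝ))) (r := C))
    (hC.mono fun k hk => by simpa using hk)
  have hφt := hφ.tendsto_atTop
  have hyφ : Tendsto (fun k => y (φ k)) atTop (𝓝 x) := hy.comp hφt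
  have hcoord : ∀ i, Tendsto (fun k => (q (φ k)).1 i) atTop (𝓝 (q₀.1 i)) := fun i =>
    (((continuous_apply i).comp continuous_fst).tendsto q₀).comp hlim
  refine ⟨q₀, (mem_multiplierSet_iff hP hX hxX q₀).2 ⟨fun i => ?_, fun z hz => ?_, fun i => ?_⟩⟩
  · exact ge_of_tendsto' (hcoord i) fun k => hq _ i
  · have h1 : Tendsto (fun k => constraintDeriv g h (y (φ k)) (q (φ k))) atTop
        (𝓝 (constraintDeriv g h x q₀)) :=
      tendsto_constraintDeriv hg hh hyφ hlim
    have h2 : Tendsto (fun k => z - y (φ k)) atTop (𝓝 (z - x)) := tendsto_const_nhds.sub hyφ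
    have h3 : Tendsto (fun k => P (y (φ k))) atTop (𝓝 (P x)) := (hPc.tendsto x).comp hyφ
    have hrφ : Tendsto (fun k => fderiv ℝ f (y (φ k)) + innerSL ℝ (y (φ k) - x)) atTop
        (𝓝 (fderiv ℝ f x)) := hr.comp hφt
    have h4 := (tendsto_clm_apply (hrφ.add h1) h2).add_const (P z)
    exact ge_of_tendsto' (h4.sub h3) fun k => hvi (φ k) z hz
  · by_cases hi : g i x = 0
    · rw [hi, mul_zero]
    · rw [tendsto_nhds_unique (hcoord i) (tendsto_const_nhds.congr'
        ((hφt.eventually (hact i hi)).mono fun k hk => hk.symm)), zero_mul]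

end NonsmoothNLP

theorem mainTheorem2 {n m p : ℕ}
    (f P : EuclideanSpace ℝ (Fin n) → ℝ)
    (g : Fin m → EuclideanSpace ℝ (Fin n) → ℝ)
    (h : Fin p → EuclideanSpace ℝ (Fin n) → ℝ)
    (X : Set (EuclideanSpace ℝ (Fin n)))
    (hf : ContDiff ℝ 1 f) (hg : ∀ i, ContDiff ℝ 1 (g i)) (hh : ∀ i, ContDiff ℝ 1 (h i))
    (hP : ConvexOn ℝ Set.univ P) (hXclosed : IsClosed X) (hXconvex : Convex ℝ X)
    (xstar : EuclideanSpace ℝ (Fin n))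
    (hmin : NonsmoothNLP.IsLocalMinimizer (fun x => f x + P x)
      (NonsmoothNLP.feasibleSet g h X) xstar)
    (hrob : NonsmoothNLP.RobinsonCondition g h X xstar) :
    (∃ (lam : Fin m → ℝ) (mu : Fin p → ℝ),
      (∀ i, 0 ≤ lam i) ∧
      (0 : EuclideanSpace ℝ (Fin n)) ∈
        {gradient f xstar} + NonsmoothNLP.subdifferential P xstar
          + {∑ i, lam i • gradient (g i) xstar} + {∑ i, mu i • gradient (h i) xstar}
          + NonsmoothNLP.normalCone X xstar ∧
      ∀ i, lam i * g i xstar = 0) ∧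
    Convex ℝ (NonsmoothNLP.multiplierSet f P g h X xstar) ∧
    IsCompact (NonsmoothNLP.multiplierSet f P g h X xstar) := by
  obtain ⟨q, hq⟩ := NonsmoothNLP.multiplierSet_nonempty hf hg hh hP hXclosed hXconvex hmin hrob
  have hx := hmin.1.2.2
  exact ⟨⟨q.1, q.2, hq⟩, NonsmoothNLP.convex_multiplierSet hP hXconvex hx,
    Metric.isCompact_of_isClosed_isBounded
      (NonsmoothNLP.isClosed_multiplierSet hP hXconvex hx)
      (NonsmoothNLP.isBounded_multiplierSet hg hh hP hXconvex hx hrob)⟩
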